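/- Let $d\ge1$, $\lambda>0$ and $\theta<1$. For $h>0$ with $\lambda h^d\le\theta$, let $\{x_z\}_{z\in\mathbb Z^d}$ and $\{b_z\}_{z\in\mathbb Z^d}$ be independent random variables, where $x_z$ is uniformly distributed in the cube $hz+[0,h)^d$ and $b_z$ is a Bernoulli variable of parameter $\lambda h^d$. Consider the point process $\mathcal P_h=\{x_z: b_z=1\}$ (an approximation, as $h\downarrow0$, of the Poisson process of intensity $\lambda$). Below, $F,G,H$ always denote finite sets of indices of points of $\mathcal P_h$, that is, finite subsets of $\{z: b_z=1\}$; $|F|$ is the number of elements of $F$; $J_H=\bigcap_{z\in H}B(x_z)$, with $B(x)$ the open unit ball centered at $x$; and $\mathbb E_h[\,\cdot\,]=\mathbb E\big[h^{-d}\int_{[0,h)^d}\cdot\,dx\big]$ is the expectation averaged over the space variable $x\in[0,h)^d$. A random function of indices is a family of $\mathbb R^m$-valued random fields $R(F)=R(F)(x)$ such that $R(F)$ is a measurable function of the space variable $x$, of the positions $\{x_z\}_{z\in F}$ of the points with indices in $F$, and of an additional random environment that is independent of $\{(x_z,b_z)\}_{z}$. Assume that $R$ is bounded, that $R(\varnothing)=0$,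 and that $R$ is approximately local: there exist $\kappa>0$ and $K<\infty$ such that, almost surely and for almost every $x\in[0,h)^d$, for all $F$, $$|R(F)|\le K\sum_{z\in F}e^{-\kappa|x_z|}.$$ Then there exists a constant $C\in(0,\infty)$, depending only on $d$, $\lambda$ and $\theta$ (in particular neither on $h$ nor on $R,\kappa,K$), such that for all $h>0$ with $\lambda h^d\le\theta$, all such $R$, and all integers $a,b,c\ge1$, $$\mathbb E_h\bigg[\sum_{\substack{|H|=a,\,|G|=b\\ H\cap G=\varnothing}}\mathbf 1_{J_H}\Big|\sum_{\substack{|F|=c\\ F\cap(H\cup G)=\varnothing}}R(F\cup G)\Big|^2\bigg]\ \le\ \frac{C^a}{a!}\ \mathbb E_h\bigg[\sum_{|G|=b}\Big|\sum_{\substack{|F|=c\\ F\cap G=\varnothing}}R(F\cup G)\Big|^2\bigg].$$ Both sides are understood in $[0,\infty]$, with $\big|\sum_F R(F\cup G)\big|^2:=\infty$ whenever the series over $F$ is not absolutely convergent, and with $0\cdot\infty=0$ for the products with $\mathbf 1_{J_H}$. -/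

import Mathlib

open MeasureTheory ProbabilityTheory
open scoped ENNReal

namespace PoissonApprox

/-- Euclidean space `ℝ^d`. -/
abbrev Pt (d : ℕ) : Type := EuclideanSpace ℝ (Fin d)

/-- Labels of the cubes of side `h`: the label `z` stands for the corner `h z` of the cube, and it
is also the index of the (at most one) point of the process in this cube. -/
abbrev Site (d : ℕ) : Type := Fin d → ℤ

/-- The cube `h z + [0,h)^d`. -/
def cube {d : ℕ} (h : ℝ) (z : Site d) : Set (Pt d) :=
  {y | ∀ i, h * (z i : ℝ) ≤ y i ∧ y i < h * (z i : ℝ) + h}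

/-- The data of the point process `P_h = {x_z : b_z = 1}` of intensity `lam`: the point `x_z` is
uniformly distributed in the cube of label `z`, the variable `b_z` is Bernoulli of parameter
`lam * h ^ d`, and all the variables `x_z`, `b_z` are independent. -/
structure IsCubeProcess {Ω : Type*} [MeasurableSpace Ω] (μ : Measure Ω) {d : ℕ} (lam h : ℝ)
    (X : Site d → Ω → Pt d) (b : Site d → Ω → Bool) : Prop where
  measurable_point : ∀ z, Measurable (X z)
  measurable_mark : ∀ z, Measurable (b z)
  uniform_point : ∀ z, μ.map (X z) = ProbabilityTheory.cond volume (cube h z)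
  bernoulli_mark : ∀ z, μ {ω | b z ω = true} = ENNReal.ofReal (lam * h ^ d)
  indep_sites : iIndepFun (fun z ω => (X z ω, b z ω)) μ
  indep_mark : ∀ z, IndepFun (X z) (b z) μ

/-- The (random) set of indices of the points of the process. -/
def active {Ω : Type*} {d : ℕ} (b : Site d → Ω → Bool) (ω : Ω) : Set (Site d) :=
  {z | b z ω = true}

/-- A random function of indices `F ↦ R(F)`, with values in `ℝ^m`: for every finite set `F` of
indices, `R(F)` is a measurable function of an additional random environment `s`, of the positions
of the points with indices in `F`, and of the space variable `x`. -/
structure RandomIndexFunction (d m : ℕ) (S : Type*) [MeasurableSpace S] where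
  toFun : (F : Finset (Site d)) → S → (F → Pt d) → Pt d → EuclideanSpace ℝ (Fin m)
  measurable_toFun : ∀ F : Finset (Site d), Measurable
    (fun q : S × (F → Pt d) × Pt d => toFun F q.1 q.2.1 q.2.2)

/-- The value `R(F)` when the environment is `s` and the points are at the positions `p`. -/
def RandomIndexFunction.eval {d m : ℕ} {S : Type*} [MeasurableSpace S]
    (R : RandomIndexFunction d m S) (s : S) (p : Site d → Pt d) (x : Pt d)
    (F : Finset (Site d)) : EuclideanSpace ℝ (Fin m) :=
  R.toFun F s (fun z => p z) x

/-- The sets `F` of `k` indices of points of the process with `F ∩ A = ∅`. -/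
def tuples {d : ℕ} (act : Set (Site d)) (k : ℕ) (A : Finset (Site d)) : Set (Finset (Site d)) :=
  {F | (F : Set (Site d)) ⊆ act ∧ F.card = k ∧ Disjoint F A}

/-- The intersection `J_H` of the open unit balls centered at the points with indices in `H`. -/
def interBalls {d : ℕ} (p : Site d → Pt d) (H : Finset (Site d)) : Set (Pt d) :=
  ⋂ z ∈ H, Metric.ball (p z) 1

open Classical in
/-- The square `|∑ f|²` as an element of `[0,∞]`. It is `∞` if the series does not converge
unconditionally (equivalently, absolutely). -/
noncomputable def sqNormSum {α : Type*} {m : ℕ} (f : α → EuclideanSpace ℝ (Fin m)) : ℝ≥0∞ :=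
  if Summable f then ‖∑' a, f a‖ₑ ^ 2 else ∞

/-- The quantity `|∑ R(F ∪ G)|²`, the sum being over the sets `F` of `k` indices of points of the
process with `F ∩ A = ∅`. -/
noncomputable def sqSum {d m : ℕ} (act : Set (Site d))
    (r : Finset (Site d) → EuclideanSpace ℝ (Fin m)) (k : ℕ) (G A : Finset (Site d)) : ℝ≥0∞ :=
  sqNormSum (fun F : tuples act k A => r ((F : Finset (Site d)) ∪ G))

/-- The averaged expectation `E_h`: the expectation of the average over the cube `[0,h)^d`. -/
noncomputable def expect {Ω : Type*} [MeasurableSpace Ω] (μ : Measure Ω) {d : ℕ} (h : ℝ)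
    (f : Ω → Pt d → ℝ≥0∞) : ℝ≥0∞ :=
  ∫⁻ ω, (⨍⁻ x in cube h (0 : Site d), f ω x ∂volume) ∂μ

end PoissonApprox

namespace PoissonApprox

/-! ### Elementary symmetric sums -/

/-! Independence of the environment and Tonelli reduce the claim to a fixed environment and a fixed
`x`, and the inequality then holds pointwise in both. For a given `H`, the event that every site of
`H` carries a point within distance 1 of `x` depends on the sites of `H` only. The inner sums over
`G` and `F` avoid `H`, so they equal the right-hand functional evaluated at the configuration with
`H` erased, and are independent of that event (`lintegral_indicator_mul_erase`). Conversely, with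
probability at least `(1 - θ) ^ |H|` the sites of `H` are empty and erasing them changes nothing. By
independence again, the erased expectation is at most `(1 - θ)⁻¹ ^ |H|` times the full one
(`lintegral_erase_le`). It remains to sum over `H` the products of the site probabilities `q z`.
This is an elementary symmetric sum, at most `(∑ q z) ^ a / a!`, and `∑ q z` is bounded by `lam`
times the volume of the unit ball because the cubes are disjoint (`tsum_measure_ball_le`). -/

open Classical in
/-- The elementary symmetric sum of degree `n` is at most the `n`-th power of the sum over `n!`. -/
theorem factorial_mul_tsum_card_eq_le {ι : Type*} (q : ι → ℝ≥0∞) (n : ℕ) :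
    (n.factorial : ℝ≥0∞) * ∑' H : Finset ι, (if H.card = n then ∏ z ∈ H, q z else 0)
      ≤ (∑' z, q z) ^ n := by
  induction n with
  | zero =>
    simp only [Finset.card_eq_zero]
    rw [tsum_eq_single ∅ (fun H hH => by simp [hH])]
    simp
  | succ n ih =>
    have key : ((n + 1 : ℕ) : ℝ≥0∞) *
        ∑' H : Finset ι, (if H.card = n + 1 then ∏ z ∈ H, q z else 0)
        ≤ (∑' z, q z) * ∑' H : Finset ι, (if H.card = n then ∏ z ∈ H, q z else 0) := by
      -- Double counting: each `H` with `n + 1` elements is counted once for each choice of a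
      -- distinguished `z ∈ H`.
      have expand : ∀ H : Finset ι,
          ((n + 1 : ℕ) : ℝ≥0∞) * (if H.card = n + 1 then ∏ z ∈ H, q z else 0) =
          ∑' z, (if z ∈ H ∧ H.card = n + 1 then q z * ∏ w ∈ H.erase z, q w else 0) := by
        intro H
        rw [tsum_eq_sum (s := H) (fun z hz => by simp [hz])]
        split_ifs with hH
        · rw [Finset.sum_congr rfl (g := fun _ => ∏ z ∈ H, q z)
            (fun z hz => by rw [if_pos ⟨hz, hH⟩, Finset.mul_prod_erase _ _ hz])]
          rw [Finset.sum_const, hH, nsmul_eq_mul]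
        · simp [hH]
      rw [← ENNReal.tsum_mul_left, tsum_congr expand, ENNReal.tsum_comm,
        ← ENNReal.tsum_mul_right]
      refine ENNReal.tsum_le_tsum fun z => ?_
      rw [← ENNReal.tsum_mul_left]
      -- For fixed `z`, erasing `z` is injective on the sets containing it, but reaches only sets
      -- avoiding `z`; this is where equality is lost.
      have hinj : Function.Injective (fun H : {H : Finset ι // z ∈ H} => H.1.erase z) := by
        intro H H' hHH'
        apply Subtype.ext
        rw [← Finset.insert_erase H.2, ← Finset.insert_erase H'.2]
        exact congrArg (insert z) hHH'
      refine le_trans (le_of_eq ?_) (ENNReal.tsum_comp_le_tsum_of_injective hinj _)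
      rw [← tsum_subtype_eq_of_support_subset (s := {H : Finset ι | z ∈ H})]
      · refine tsum_congr fun H => ?_
        have hc : (H.1.erase z).card + 1 = H.1.card := Finset.card_erase_add_one H.2
        have hz : z ∈ H.1 := H.2
        by_cases h1 : H.1.card = n + 1
        · rw [if_pos ⟨hz, h1⟩, if_pos (by omega)]
        · rw [if_neg (fun h => h1 h.2), if_neg (by omega), mul_zero]
      · intro H hH
        by_contra hz
        exact hH (if_neg fun h => hz h.1)
    calc ((n + 1).factorial : ℝ≥0∞) *
          ∑' H : Finset ι, (if H.card = n + 1 then ∏ z ∈ H, q z else 0)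
        = n.factorial * (((n + 1 : ℕ) : ℝ≥0∞) *
          ∑' H : Finset ι, (if H.card = n + 1 then ∏ z ∈ H, q z else 0)) := by
          rw [Nat.factorial_succ, Nat.cast_mul, ← mul_assoc, mul_comm (n.factorial : ℝ≥0∞)]
      _ ≤ n.factorial * ((∑' z, q z) *
          ∑' H : Finset ι, (if H.card = n then ∏ z ∈ H, q z else 0)) := by gcongr
      _ ≤ (∑' z, q z) * (∑' z, q z) ^ n := by
          rw [mul_left_comm]; gcongr
      _ = (∑' z, q z) ^ (n + 1) := (pow_succ' _ _).symm

/-! ### Squares of series: restriction of the index set and measurability -/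

/-- Moves a random index set into the summand, so that measurability can be checked over a fixed
countable type. -/
theorem sqNormSum_subtype {α : Type*} {m : ℕ} (s : Set α) (f : α → EuclideanSpace ℝ (Fin m)) :
    sqNormSum (fun a : s => f a) = sqNormSum (s.indicator f) := by
  unfold sqNormSum
  rw [tsum_subtype s f, show Summable (fun a : s => f a) = Summable (s.indicator f) from
    propext summable_subtype_iff_indicator]

theorem measurable_sqNormSum {α β : Type*} [Countable α] [MeasurableSpace β] {m : ℕ}
    {f : β → α → EuclideanSpace ℝ (Fin m)} (hf : ∀ a, Measurable fun y => f y a) :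
    Measurable fun y => sqNormSum (f y) := by
  have hs : MeasurableSet {y | Summable (f y)} := by
    -- In finite dimension summability is absolute, hence finiteness of a measurable `[0,∞]`-valued
    -- sum.
    have : {y | Summable (f y)} = {y | ∑' a, ‖f y a‖ₑ ≠ ∞} := by
      ext y
      simp only [Set.mem_ofPred_eq]
      rw [← summable_norm_iff]
      simp only [enorm_eq_nnnorm, ENNReal.tsum_coe_ne_top_iff_summable, ← NNReal.summable_coe,
        coe_nnnorm]
    rw [this]
    exact (Measurable.tsum fun a => (hf a).enorm) (measurableSet_singleton _).compl
  unfold sqNormSum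
  exact Measurable.ite hs ((Measurable.tsum hf).enorm.pow_const 2) measurable_const

/-! ### Configurations -/

/-- The positions and marks of all the sites. -/
abbrev Config (d : ℕ) : Type := Site d → Pt d × Bool

/-- The indices of the points of a configuration. -/
def Config.act {d : ℕ} (y : Config d) : Set (Site d) := {z | (y z).2 = true}

/-- The configuration in which the sites of `H` carry no point. -/
def Config.erase {d : ℕ} (H : Finset (Site d)) (y : Config d) : Config d :=
  -- The position `0` is a dummy: with mark `false` the site enters no index set.
  fun z => if z ∈ H then (0, false) else y z

theorem Config.act_erase {d : ℕ} (H : Finset (Site d)) (y : Config d) :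
    (y.erase H).act = y.act \ H := by
  ext z
  by_cases hz : z ∈ H <;> simp [Config.act, Config.erase, hz]

theorem Config.measurable_erase {d : ℕ} (H : Finset (Site d)) :
    Measurable (Config.erase H : Config d → Config d) := by
  refine measurable_pi_lambda _ fun z => ?_
  by_cases hz : z ∈ H
  · simp only [Config.erase, hz, if_true]; exact measurable_const
  · simp only [Config.erase, hz, if_false]; exact measurable_pi_apply z

theorem Config.measurableSet_subset_act {d : ℕ} (F : Finset (Site d)) :
    MeasurableSet {y : Config d | (F : Set (Site d)) ⊆ y.act} := by
  have : {y : Config d | (F : Set (Site d)) ⊆ y.act} =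
      ⋂ z ∈ F, (fun y : Config d => (y z).2) ⁻¹' {true} := by
    ext y
    simp [Set.subset_def, Config.act]
  rw [this]
  exact Finset.measurableSet_biInter _ fun z _ =>
    (measurable_snd.comp (measurable_pi_apply z)) (measurableSet_singleton _)

theorem RandomIndexFunction.measurable_eval {d m : ℕ} {S : Type*} [MeasurableSpace S]
    (R : RandomIndexFunction d m S) (F : Finset (Site d)) :
    Measurable fun q : S × Config d × Pt d => R.eval q.1 (fun z => (q.2.1 z).1) q.2.2 F := by
  have : Measurable fun q : S × Config d × Pt d =>
      (q.1, (fun z : F => (q.2.1 z).1), q.2.2) := by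
    fun_prop
  exact (R.measurable_toFun F).comp this

theorem RandomIndexFunction.eval_congr {d m : ℕ} {S : Type*} [MeasurableSpace S]
    (R : RandomIndexFunction d m S) (s : S) {p p' : Site d → Pt d} (x : Pt d)
    {F : Finset (Site d)} (h : ∀ z ∈ F, p z = p' z) : R.eval s p x F = R.eval s p' x F := by
  unfold RandomIndexFunction.eval
  congr 1
  ext1 z
  exact h z z.2

/-- The sum over the sets `G` of `j` indices of the squares of the sums over `F`. -/
noncomputable def sumSq {d m : ℕ} (act : Set (Site d))
    (r : Finset (Site d) → EuclideanSpace ℝ (Fin m)) (j k : ℕ) : ℝ≥0∞ :=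
  ∑' G : tuples act j ∅, sqSum act r k G G

theorem sumSq_congr {d m : ℕ} {act : Set (Site d)}
    {r r' : Finset (Site d) → EuclideanSpace ℝ (Fin m)}
    (h : ∀ F : Finset (Site d), (F : Set (Site d)) ⊆ act → r F = r' F) (j k : ℕ) :
    sumSq act r j k = sumSq act r' j k := by
  unfold sumSq sqSum
  refine tsum_congr fun G => congrArg sqNormSum (funext fun F => h _ ?_)
  rw [Finset.coe_union]
  exact Set.union_subset F.2.1 G.2.1

theorem tuples_union {d : ℕ} (act : Set (Site d)) (k : ℕ) (H A : Finset (Site d)) :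
    tuples act k (H ∪ A) = tuples (act \ H) k A := by
  ext F
  simp only [tuples, Set.mem_ofPred_eq, Finset.disjoint_union_right, Set.subset_sdiff,
    Finset.disjoint_coe]
  tauto

theorem sqSum_union {d m : ℕ} (act : Set (Site d))
    (r : Finset (Site d) → EuclideanSpace ℝ (Fin m)) (k : ℕ) (G H A : Finset (Site d)) :
    sqSum act r k G (H ∪ A) = sqSum (act \ H) r k G A := by
  unfold sqSum
  rw [tuples_union]

theorem sqSum_eq_indicator {d m : ℕ} (act : Set (Site d))
    (r : Finset (Site d) → EuclideanSpace ℝ (Fin m)) (k : ℕ) (G A : Finset (Site d)) :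
    sqSum act r k G A = sqNormSum ((tuples act k A).indicator fun F => r (F ∪ G)) :=
  sqNormSum_subtype (tuples act k A) fun F => r (F ∪ G)

/-- Requiring both `G` and `F` to avoid `H` is the same as deleting `H` from the active set. -/
theorem tsum_sqSum_eq_sumSq {d m : ℕ} (act : Set (Site d))
    (r : Finset (Site d) → EuclideanSpace ℝ (Fin m)) (j k : ℕ) (H : Finset (Site d)) :
    ∑' G : tuples act j H, sqSum act r k G (H ∪ G) = sumSq (act \ H) r j k := by
  have h1 : tuples act j H = tuples (act \ H) j ∅ := by
    rw [← tuples_union, Finset.union_empty]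
  unfold sumSq
  simp only [sqSum_union]
  rw [h1]

/-- The inner sums of the left-hand side, as a function of the configuration. -/
noncomputable def RandomIndexFunction.sumSq {d m : ℕ} {S : Type*} [MeasurableSpace S]
    (R : RandomIndexFunction d m S) (j k : ℕ) (s : S) (y : Config d) (x : Pt d) : ℝ≥0∞ :=
  PoissonApprox.sumSq y.act (R.eval s (fun z => (y z).1) x) j k

/-- Only sets `F ∪ G` disjoint from `H` occur, and on these `R` does not see the erased positions.
-/
theorem RandomIndexFunction.sumSq_erase {d m : ℕ} {S : Type*} [MeasurableSpace S]
    (R : RandomIndexFunction d m S) (j k : ℕ) (s : S) (y : Config d) (x : Pt d)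
    (H : Finset (Site d)) :
    R.sumSq j k s (y.erase H) x =
      PoissonApprox.sumSq (y.act \ H) (R.eval s (fun z => (y z).1) x) j k := by
  unfold RandomIndexFunction.sumSq
  rw [Config.act_erase]
  refine sumSq_congr (fun F hF => R.eval_congr s x fun z hz => ?_) j k
  have : z ∉ H := fun h => (hF hz).2 h
  simp [Config.erase, this]

theorem RandomIndexFunction.measurable_sumSq {d m : ℕ} {S : Type*} [MeasurableSpace S]
    (R : RandomIndexFunction d m S) (j k : ℕ) :
    Measurable fun q : S × Config d × Pt d => R.sumSq j k q.1 q.2.1 q.2.2 := by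
  classical
  have hact : ∀ F : Finset (Site d),
      MeasurableSet {q : S × Config d × Pt d | (F : Set (Site d)) ⊆ q.2.1.act} := fun F =>
    (measurable_fst.comp measurable_snd) (Config.measurableSet_subset_act F)
  have htup : ∀ (n : ℕ) (F A : Finset (Site d)),
      MeasurableSet {q : S × Config d × Pt d | F ∈ tuples q.2.1.act n A} := by
    intro n F A
    exact (hact F).inter (MeasurableSet.const _)
  have hG : ∀ G : Finset (Site d), Measurable fun q : S × Config d × Pt d =>
      sqSum q.2.1.act (R.eval q.1 (fun z => (q.2.1 z).1) q.2.2) k G G := by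
    intro G
    simp only [sqSum_eq_indicator]
    refine measurable_sqNormSum fun F => ?_
    simp only [Set.indicator_apply]
    exact Measurable.ite (htup k F G) (R.measurable_eval (F ∪ G)) measurable_const
  unfold RandomIndexFunction.sumSq PoissonApprox.sumSq
  have hsub : ∀ q : S × Config d × Pt d,
      ∑' G : tuples q.2.1.act j ∅,
        sqSum q.2.1.act (R.eval q.1 (fun z => (q.2.1 z).1) q.2.2) k G G =
      ∑' G, (tuples q.2.1.act j ∅).indicator
        (fun G => sqSum q.2.1.act (R.eval q.1 (fun z => (q.2.1 z).1) q.2.2) k G G) G :=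
    fun q => tsum_subtype (tuples q.2.1.act j ∅)
      fun G => sqSum q.2.1.act (R.eval q.1 (fun z => (q.2.1 z).1) q.2.2) k G G
  simp only [hsub]
  refine Measurable.tsum fun G => ?_
  simp only [Set.indicator_apply]
  exact Measurable.ite (htup j G ∅) (hG G) measurable_const

/-! ### Cubes -/

theorem cube_eq_preimage {d : ℕ} (h : ℝ) (z : Site d) :
    cube h z = WithLp.ofLp ⁻¹' (Set.univ.pi fun i => Set.Ico (h * (z i : ℝ)) (h * z i + h)) := by
  ext y
  simp [cube, Set.mem_pi]

theorem measurableSet_cube {d : ℕ} (h : ℝ) (z : Site d) : MeasurableSet (cube h z) := by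
  rw [cube_eq_preimage]
  exact (PiLp.volume_preserving_ofLp (Fin d)).measurable
    (MeasurableSet.univ_pi fun i => measurableSet_Ico)

theorem volume_cube {d : ℕ} {h : ℝ} (hh : 0 ≤ h) (z : Site d) :
    volume (cube h z) = ENNReal.ofReal (h ^ d) := by
  rw [cube_eq_preimage, (PiLp.volume_preserving_ofLp (Fin d)).measure_preimage
    (MeasurableSet.univ_pi fun i => measurableSet_Ico).nullMeasurableSet, Real.volume_pi_Ico]
  simp [ENNReal.ofReal_pow hh]

theorem pairwise_disjoint_cube {d : ℕ} {h : ℝ} (hh : 0 < h) :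
    Pairwise (Function.onFun Disjoint (cube h : Site d → Set (Pt d))) := by
  have hle : ∀ {z w : Site d} {y : Pt d}, y ∈ cube h z → y ∈ cube h w → ∀ i, z i ≤ w i := by
    intro z w y hz hw i
    have h1 : h * (z i : ℝ) < h * ((w i : ℝ) + 1) := by linarith [(hz i).1, (hw i).2]
    have h2 : (z i : ℝ) < (w i : ℝ) + 1 := lt_of_mul_lt_mul_left h1 hh.le
    exact Int.lt_add_one_iff.1 (by exact_mod_cast h2)
  intro z w hzw
  refine Set.disjoint_left.2 fun y hz hw => hzw (funext fun i => ?_)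
  exact le_antisymm (hle hz hw i) (hle hw hz i)

/-! ### Independence of the sites -/

section Sites

variable {Ω : Type*} [mΩ : MeasurableSpace Ω] {μ : Measure Ω} {d : ℕ} {lam h : ℝ}
  {X : Site d → Ω → Pt d} {b : Site d → Ω → Bool}

theorem IsCubeProcess.measurable_site (hP : IsCubeProcess μ lam h X b) (z : Site d) :
    Measurable fun ω => (X z ω, b z ω) :=
  (hP.measurable_point z).prodMk (hP.measurable_mark z)

theorem IsCubeProcess.measurable_config (hP : IsCubeProcess μ lam h X b) :
    Measurable fun ω (z : Site d) => (X z ω, b z ω) :=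
  measurable_pi_lambda _ hP.measurable_site

/-- What happens at the sites of `H` is independent of the rest of the configuration. -/
theorem IsCubeProcess.lintegral_indicator_mul_erase (hP : IsCubeProcess μ lam h X b)
    (H : Finset (Site d)) {T : Set (Pt d × Bool)} (hT : MeasurableSet T)
    {f : Config d → ℝ≥0∞} (hf : Measurable f) :
    ∫⁻ ω, (⋂ z ∈ H, {ω | (X z ω, b z ω) ∈ T}).indicator 1 ω *
        f (Config.erase H fun z => (X z ω, b z ω)) ∂μ =
      (∏ z ∈ H, μ {ω | (X z ω, b z ω) ∈ T}) *
        ∫⁻ ω, f (Config.erase H fun z => (X z ω, b z ω)) ∂μ := by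
  let m : Site d → MeasurableSpace Ω := fun z =>
    MeasurableSpace.comap (fun ω => (X z ω, b z ω)) inferInstance
  have hmle : ∀ z, m z ≤ mΩ := fun z => (hP.measurable_site z).comap_le
  -- The indicator is measurable for the first of these σ-algebras, the erased configuration for the
  -- second.
  have hind : Indep (⨆ z ∈ (H : Set (Site d)), m z) (⨆ z ∈ (H : Set (Site d))ᶜ, m z) μ :=
    indep_iSup_of_disjoint hmle hP.indep_sites.iIndep disjoint_compl_right
  have hset : MeasurableSet[⨆ z ∈ (H : Set (Site d)), m z]
      (⋂ z ∈ H, {ω | (X z ω, b z ω) ∈ T}) := by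
    refine Finset.measurableSet_biInter _ fun z hz => ?_
    exact le_biSup m (show z ∈ (H : Set (Site d)) from hz) _ ⟨T, hT, rfl⟩
  have herase : Measurable[⨆ z ∈ (H : Set (Site d))ᶜ, m z]
      fun ω => Config.erase H fun z => (X z ω, b z ω) := by
    refine @measurable_pi_lambda _ _ _ (_) _ _ fun z => ?_
    by_cases hz : z ∈ H
    · simp only [Config.erase, hz, if_true]; exact measurable_const
    · simp only [Config.erase, hz, if_false]
      exact (comap_measurable _).mono
        (le_biSup m (show z ∈ (H : Set (Site d))ᶜ from hz)) le_rfl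
  have hone : Measurable[⨆ z ∈ (H : Set (Site d)), m z]
      ((⋂ z ∈ H, {ω | (X z ω, b z ω) ∈ T}).indicator (1 : Ω → ℝ≥0∞)) :=
    Measurable.indicator (measurable_const (a := (1 : ℝ≥0∞))) hset
  refine (lintegral_mul_eq_lintegral_mul_lintegral_of_independent_measurableSpace
    (iSup₂_le fun z _ => hmle z) (iSup₂_le fun z _ => hmle z) hind hone
    (hf.comp herase)).trans ?_
  congr 1
  rw [lintegral_indicator_one (iSup₂_le (fun z _ => hmle z) _ hset)]
  exact hP.indep_sites.measure_inter_preimage_eq_mul H (sets := fun _ => T) fun _ _ => hT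

theorem IsCubeProcess.measure_mark_false [IsProbabilityMeasure μ]
    (hP : IsCubeProcess μ lam h X b) (hh : 0 ≤ lam * h ^ d) (z : Site d) :
    μ {ω | b z ω = false} = ENNReal.ofReal (1 - lam * h ^ d) := by
  have hc : {ω | b z ω = false} = {ω | b z ω = true}ᶜ := by
    ext ω; simp
  have hm : MeasurableSet {ω | b z ω = true} :=
    hP.measurable_mark z (measurableSet_singleton true)
  rw [hc, prob_compl_eq_one_sub hm, hP.bernoulli_mark, ENNReal.ofReal_sub _ hh, ENNReal.ofReal_one]

/-- Erasing the sites of `H` costs at most a factor `(1 - θ)⁻¹` per site. -/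
theorem IsCubeProcess.lintegral_erase_le [IsProbabilityMeasure μ]
    (hP : IsCubeProcess μ lam h X b) (hh : 0 ≤ lam * h ^ d) {θ : ℝ} (hle : lam * h ^ d ≤ θ)
    (H : Finset (Site d)) {f : Config d → ℝ≥0∞} (hf : Measurable f)
    (hfe : ∀ y : Config d, (∀ z ∈ H, (y z).2 = false) → f (y.erase H) = f y) :
    ENNReal.ofReal (1 - θ) ^ H.card *
        ∫⁻ ω, f (Config.erase H fun z => (X z ω, b z ω)) ∂μ ≤
      ∫⁻ ω, f (fun z => (X z ω, b z ω)) ∂μ := by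
  have hT : MeasurableSet (Prod.snd ⁻¹' {false} : Set (Pt d × Bool)) :=
    measurable_snd (measurableSet_singleton _)
  calc _ ≤ (∏ z ∈ H, μ {ω | (X z ω, b z ω) ∈ (Prod.snd ⁻¹' {false} : Set (Pt d × Bool))}) *
        ∫⁻ ω, f (Config.erase H fun z => (X z ω, b z ω)) ∂μ := by
        gcongr
        rw [← Finset.prod_const]
        refine Finset.prod_le_prod' fun z _ => ?_
        refine le_trans ?_ (hP.measure_mark_false hh z).ge
        exact ENNReal.ofReal_le_ofReal (by linarith)
    _ ≤ _ := by
        -- The product of probabilities is reabsorbed as the indicator that `H` is empty; on that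
        -- event erasing does not change `f`.
        rw [← hP.lintegral_indicator_mul_erase H hT hf]
        refine lintegral_mono fun ω => ?_
        by_cases hω : ω ∈ ⋂ z ∈ H,
            {ω | (X z ω, b z ω) ∈ (Prod.snd ⁻¹' {false} : Set (Pt d × Bool))}
        · rw [Set.indicator_of_mem hω, Pi.one_apply, one_mul, hfe]
          simpa using hω
        · rw [Set.indicator_of_notMem hω, zero_mul]
          exact zero_le

/-- The factor `h ^ d` in the Bernoulli parameter cancels the normalization of the uniform law on
the cube. -/
theorem IsCubeProcess.measure_mark_true_ball (hP : IsCubeProcess μ lam h X b) (hlam : 0 ≤ lam)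
    (hh : 0 < h) (x : Pt d) (z : Site d) :
    μ {ω | (X z ω, b z ω) ∈ Metric.ball x 1 ×ˢ {true}} =
      ENNReal.ofReal lam * volume (cube h z ∩ Metric.ball x 1) := by
  have h1 : {ω | (X z ω, b z ω) ∈ Metric.ball x 1 ×ˢ {true}} =
      X z ⁻¹' Metric.ball x 1 ∩ b z ⁻¹' {true} := by
    ext ω; simp
  rw [h1, (hP.indep_mark z).measure_inter_preimage_eq_mul _ _ Metric.isOpen_ball.measurableSet
    (measurableSet_singleton _), ← Measure.map_apply (hP.measurable_point z)
    Metric.isOpen_ball.measurableSet, hP.uniform_point,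
    ProbabilityTheory.cond_apply (measurableSet_cube h z), volume_cube hh.le]
  change _ * μ {ω | b z ω = true} = _
  have hpos : 0 < h ^ d := pow_pos hh d
  rw [hP.bernoulli_mark, ENNReal.ofReal_mul hlam]
  have h0 : ENNReal.ofReal (h ^ d) ≠ 0 := by simpa using hpos
  calc (ENNReal.ofReal (h ^ d))⁻¹ * volume (cube h z ∩ Metric.ball x 1) *
        (ENNReal.ofReal lam * ENNReal.ofReal (h ^ d))
      = ((ENNReal.ofReal (h ^ d))⁻¹ * ENNReal.ofReal (h ^ d)) *
        (ENNReal.ofReal lam * volume (cube h z ∩ Metric.ball x 1)) := by ring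
    _ = _ := by rw [ENNReal.inv_mul_cancel h0 ENNReal.ofReal_ne_top, one_mul]

/-- The pieces of the ball cut out by the disjoint cubes have total volume at most that of the ball,
whence a bound uniform in `h` and `x`. -/
theorem IsCubeProcess.tsum_measure_ball_le (hP : IsCubeProcess μ lam h X b) (hlam : 0 ≤ lam)
    (hh : 0 < h) (x : Pt d) :
    ∑' z, μ {ω | (X z ω, b z ω) ∈ Metric.ball x 1 ×ˢ {true}} ≤
      ENNReal.ofReal lam * volume (Metric.ball (0 : Pt d) 1) := by
  simp only [hP.measure_mark_true_ball hlam hh x]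
  rw [ENNReal.tsum_mul_left, ← Measure.addHaar_ball_center volume x 1]
  gcongr
  rw [← measure_iUnion (fun z w hzw => (pairwise_disjoint_cube hh hzw).mono
    Set.inter_subset_left Set.inter_subset_left)
    fun z => (measurableSet_cube h z).inter Metric.isOpen_ball.measurableSet]
  exact measure_mono (Set.iUnion_subset fun z => Set.inter_subset_right)

end Sites

/-! ### The left-hand side -/

section

variable {d m : ℕ} {S : Type*} [MeasurableSpace S]

open Classical in
/-- The sum over `H` in the left-hand side, as a function of the configuration. -/
noncomputable def RandomIndexFunction.sumBalls (R : RandomIndexFunction d m S) (i j k : ℕ)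
    (s : S) (y : Config d) (x : Pt d) : ℝ≥0∞ :=
  ∑' H : Finset (Site d), if H.card = i then
    {y : Config d | ∀ z ∈ H, y z ∈ Metric.ball x 1 ×ˢ {true}}.indicator 1 y *
      R.sumSq j k s (y.erase H) x else 0

theorem RandomIndexFunction.sumBalls_eq (R : RandomIndexFunction d m S) (i j k : ℕ)
    (s : S) (y : Config d) (x : Pt d) :
    ∑' H : tuples y.act i ∅, ∑' G : tuples y.act j H,
        (interBalls (fun z => (y z).1) H).indicator 1 x *
          sqSum y.act (R.eval s (fun z => (y z).1) x) k G (H ∪ G) =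
      R.sumBalls i j k s y x := by
  simp only [ENNReal.tsum_mul_left, tsum_sqSum_eq_sumSq]
  rw [tsum_subtype (tuples y.act i ∅) fun H =>
    (interBalls (fun z => (y z).1) H).indicator 1 x *
      PoissonApprox.sumSq (y.act \ H) (R.eval s (fun z => (y z).1) x) j k]
  refine tsum_congr fun H => ?_
  rw [R.sumSq_erase]
  by_cases hc : H.card = i
  · rw [if_pos hc]
    by_cases ha : (H : Set (Site d)) ⊆ y.act
    · rw [Set.indicator_of_mem (show H ∈ tuples y.act i ∅ from ⟨ha, hc, by simp⟩)]
      congr 1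
      have hiff : x ∈ interBalls (fun z => (y z).1) H ↔
          y ∈ {y : Config d | ∀ z ∈ H, y z ∈ Metric.ball x 1 ×ˢ {true}} := by
        simp only [interBalls, Set.mem_iInter, Set.mem_ofPred_eq, Set.mem_prod,
          Set.mem_singleton_iff]
        refine forall₂_congr fun z hz => ?_
        -- Reading `x ∈ B(x_z)` as `x_z ∈ B(x)` turns membership in `J_H` into a separate condition
        -- on each site of `H`.
        rw [Metric.mem_ball_comm]
        exact (and_iff_left (ha hz)).symm
      by_cases hx : x ∈ interBalls (fun z => (y z).1) H
      · rw [Set.indicator_of_mem hx, Set.indicator_of_mem (hiff.1 hx)]; rfl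
      · rw [Set.indicator_of_notMem hx, Set.indicator_of_notMem (fun h => hx (hiff.2 h))]
    · rw [Set.indicator_of_notMem (fun h => ha h.1), Set.indicator_of_notMem, zero_mul]
      exact fun h => ha fun z hz => (h z hz).2
  · rw [if_neg hc, Set.indicator_of_notMem (fun h => hc h.2.1)]

theorem measurableSet_ball_mem {d : ℕ} (H : Finset (Site d)) :
    MeasurableSet {q : Config d × Pt d | ∀ z ∈ H, q.1 z ∈ Metric.ball q.2 1 ×ˢ {true}} := by
  have : {q : Config d × Pt d | ∀ z ∈ H, q.1 z ∈ Metric.ball q.2 1 ×ˢ {true}} =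
      ⋂ z ∈ H, ({q | dist (q.1 z).1 q.2 < 1} ∩ (fun q => (q.1 z).2) ⁻¹' {true}) := by
    ext q; simp
  rw [this]
  refine Finset.measurableSet_biInter _ fun z _ => MeasurableSet.inter ?_ ?_
  · exact measurableSet_lt (by fun_prop) measurable_const
  · exact (by fun_prop : Measurable fun q : Config d × Pt d => (q.1 z).2)
      (measurableSet_singleton _)

theorem RandomIndexFunction.measurable_sumBalls (R : RandomIndexFunction d m S) (i j k : ℕ) :
    Measurable fun q : S × Config d × Pt d => R.sumBalls i j k q.1 q.2.1 q.2.2 := by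
  unfold RandomIndexFunction.sumBalls
  refine Measurable.tsum fun H => ?_
  by_cases hc : H.card = i
  · simp only [hc, if_true]
    refine Measurable.mul ?_ ?_
    · exact (measurable_one.indicator (measurableSet_ball_mem H)).comp measurable_snd
    · have : Measurable fun q : S × Config d × Pt d => (q.1, q.2.1.erase H, q.2.2) :=
        measurable_fst.prodMk (((Config.measurable_erase H).comp
          (measurable_fst.comp measurable_snd)).prodMk (measurable_snd.comp measurable_snd))
      exact (R.measurable_sumSq j k).comp this
  · simp only [hc, if_false]
    exact measurable_const

/-- The estimate for a fixed environment and a fixed space variable. -/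
theorem IsCubeProcess.lintegral_sumBalls_le {Ω : Type*} [MeasurableSpace Ω] {μ : Measure Ω}
    [IsProbabilityMeasure μ] {lam h : ℝ} {X : Site d → Ω → Pt d} {b : Site d → Ω → Bool}
    (hP : IsCubeProcess μ lam h X b) (hlam : 0 < lam) (hh : 0 < h) {θ : ℝ} (hθ : θ < 1)
    (hle : lam * h ^ d ≤ θ) (R : RandomIndexFunction d m S) (i j k : ℕ) (s : S) (x : Pt d) :
    ∫⁻ ω, R.sumBalls i j k s (fun z => (X z ω, b z ω)) x ∂μ ≤
      ENNReal.ofReal ((lam * volume.real (Metric.ball (0 : Pt d) 1) / (1 - θ)) ^ i /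
        (i.factorial : ℝ)) * ∫⁻ ω, R.sumSq j k s (fun z => (X z ω, b z ω)) x ∂μ := by
  classical
  have hf : Measurable fun y : Config d => R.sumSq j k s y x :=
    (R.measurable_sumSq j k).comp (measurable_const.prodMk (measurable_id.prodMk measurable_const))
  have hfe : ∀ (H : Finset (Site d)) (y : Config d), (∀ z ∈ H, (y z).2 = false) →
      R.sumSq j k s (y.erase H) x = R.sumSq j k s y x := by
    intro H y hy
    rw [R.sumSq_erase, sdiff_eq_left.2]
    · rfl
    · refine Set.disjoint_left.2 fun z hz hzH => ?_
      rw [Config.act, Set.mem_ofPred_eq, hy z hzH] at hz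
      exact Bool.false_ne_true hz
  set E : ℝ≥0∞ := ∫⁻ ω, R.sumSq j k s (fun z => (X z ω, b z ω)) x ∂μ
  set q : Site d → ℝ≥0∞ := fun z => μ {ω | (X z ω, b z ω) ∈ Metric.ball x 1 ×ˢ {true}}
  set c : ℝ≥0∞ := ENNReal.ofReal (1 - θ)
  have hθ' : 0 < 1 - θ := sub_pos.2 hθ
  have hc0 : c ≠ 0 := by simpa [c] using hθ
  have hct : c ≠ ∞ := ENNReal.ofReal_ne_top
  have hT : MeasurableSet (Metric.ball x 1 ×ˢ {true} : Set (Pt d × Bool)) :=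
    Metric.isOpen_ball.measurableSet.prod (measurableSet_singleton _)
  have hterm : ∀ H : Finset (Site d), ∫⁻ ω, (if H.card = i then
      {y : Config d | ∀ z ∈ H, y z ∈ Metric.ball x 1 ×ˢ {true}}.indicator 1
        (fun z => (X z ω, b z ω)) *
      R.sumSq j k s (Config.erase H fun z => (X z ω, b z ω)) x else 0) ∂μ ≤
      (if H.card = i then ∏ z ∈ H, q z else 0) * ((c ^ i)⁻¹ * E) := by
    intro H
    by_cases hc : H.card = i
    · simp only [hc, if_true]
      have hind : ∀ ω, {y : Config d | ∀ z ∈ H, y z ∈ Metric.ball x 1 ×ˢ {true}}.indicator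
          (1 : Config d → ℝ≥0∞) (fun z => (X z ω, b z ω)) =
          (⋂ z ∈ H, {ω | (X z ω, b z ω) ∈ Metric.ball x 1 ×ˢ {true}}).indicator 1 ω := by
        intro ω
        simp [Set.indicator_apply]
      simp only [hind]
      rw [hP.lintegral_indicator_mul_erase H hT hf]
      gcongr
      -- Dividing by `c ^ i` is legitimate since `θ < 1` makes `c` nonzero.
      rw [mul_comm, ← div_eq_mul_inv, ENNReal.le_div_iff_mul_le
        (Or.inl (pow_ne_zero _ hc0)) (Or.inl (ENNReal.pow_ne_top hct)), mul_comm, ← hc]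
      exact hP.lintegral_erase_le (by positivity) hle H hf (hfe H)
    · simp [hc]
  have hmeas : ∀ H : Finset (Site d), Measurable fun ω => (if H.card = i then
      {y : Config d | ∀ z ∈ H, y z ∈ Metric.ball x 1 ×ˢ {true}}.indicator (1 : Config d → ℝ≥0∞)
        (fun z => (X z ω, b z ω)) *
      R.sumSq j k s (Config.erase H fun z => (X z ω, b z ω)) x else 0) := by
    intro H
    by_cases hc : H.card = i
    · simp only [hc, if_true]
      refine Measurable.mul ?_ ((hf.comp (Config.measurable_erase H)).comp hP.measurable_config)
      exact ((measurable_one.indicator (measurableSet_ball_mem H)).comp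
        (measurable_id.prodMk (measurable_const (a := x)))).comp hP.measurable_config
    · simp only [hc, if_false]; exact measurable_const
  unfold RandomIndexFunction.sumBalls
  rw [lintegral_tsum fun H => (hmeas H).aemeasurable]
  refine (ENNReal.tsum_le_tsum hterm).trans ?_
  rw [ENNReal.tsum_mul_right, ← mul_assoc]
  gcongr
  have hsum : ∑' H : Finset (Site d), (if H.card = i then ∏ z ∈ H, q z else 0) ≤
      (ENNReal.ofReal lam * volume (Metric.ball (0 : Pt d) 1)) ^ i / i.factorial := by
    rw [ENNReal.le_div_iff_mul_le (Or.inl (by exact_mod_cast i.factorial_ne_zero))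
      (Or.inl (ENNReal.natCast_ne_top _)), mul_comm]
    exact (factorial_mul_tsum_card_eq_le q i).trans
      (pow_le_pow_left' (hP.tsum_measure_ball_le hlam.le hh x) i)
  refine (mul_le_mul_left hsum _).trans (le_of_eq ?_)
  have hV : ENNReal.ofReal (volume.real (Metric.ball (0 : Pt d) 1)) =
      volume (Metric.ball (0 : Pt d) 1) := ofReal_measureReal measure_ball_lt_top.ne
  rw [ENNReal.ofReal_div_of_pos (by positivity), ENNReal.ofReal_natCast,
    ENNReal.ofReal_pow (by positivity), ENNReal.ofReal_div_of_pos hθ', ENNReal.ofReal_mul hlam.le,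
    hV, div_eq_mul_inv, div_eq_mul_inv, div_eq_mul_inv, mul_pow _ c⁻¹, ENNReal.inv_pow]
  ring

end

/-! ### Averaging over the environment and the space variable, and conclusion -/

/-- Averaged expectations of functions of the environment and of an independent configuration. -/
theorem expect_eq_lintegral {Ω : Type*} [MeasurableSpace Ω] {μ : Measure Ω}
    [IsProbabilityMeasure μ] {d : ℕ} (h : ℝ) {S : Type*} [MeasurableSpace S]
    {W : Ω → S} (hW : Measurable W) {Y : Ω → Config d} (hY : Measurable Y)
    (hind : IndepFun W Y μ) {f : S → Config d → Pt d → ℝ≥0∞}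
    (hf : Measurable fun q : S × Config d × Pt d => f q.1 q.2.1 q.2.2) :
    expect μ h (fun ω x => f (W ω) (Y ω) x) =
      (∫⁻ s, ∫⁻ x in cube h (0 : Site d), ∫⁻ ω, f s (Y ω) x ∂μ ∂volume ∂(μ.map W)) /
        volume (cube h (0 : Site d)) := by
  have hg : Measurable fun p : S × Config d =>
      ∫⁻ x in cube h (0 : Site d), f p.1 p.2 x ∂volume := by
    refine Measurable.lintegral_prod_right' (f := fun r : (S × Config d) × Pt d =>
      f r.1.1 r.1.2 r.2) ?_
    exact hf.comp ((measurable_fst.comp measurable_fst).prodMk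
      ((measurable_snd.comp measurable_fst).prodMk measurable_snd))
  have : IsProbabilityMeasure (μ.map W) := Measure.isProbabilityMeasure_map hW.aemeasurable
  have : IsProbabilityMeasure (μ.map Y) := Measure.isProbabilityMeasure_map hY.aemeasurable
  unfold expect
  simp only [setLAverage_eq, div_eq_mul_inv]
  have hgWY : Measurable fun ω => ∫⁻ x in cube h (0 : Site d), f (W ω) (Y ω) x ∂volume :=
    hg.comp (hW.prodMk hY)
  rw [lintegral_mul_const _ hgWY]
  congr 1
  -- By independence the joint law of `W` and `Y` is a product, so the environment can be frozen and
  -- integrated last.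
  rw [← lintegral_map (f := fun p : S × Config d =>
      ∫⁻ x in cube h (0 : Site d), f p.1 p.2 x ∂volume) hg (hW.prodMk hY),
    (indepFun_iff_map_prod_eq_prod_map_map hW.aemeasurable hY.aemeasurable).1 hind,
    lintegral_prod _ hg.aemeasurable]
  refine lintegral_congr fun s => ?_
  have hs : Measurable fun p : Config d × Pt d => f s p.1 p.2 :=
    hf.comp (measurable_const.prodMk measurable_id)
  rw [lintegral_map (f := fun y => ∫⁻ x in cube h (0 : Site d), f s y x ∂volume)
    (hg.comp (measurable_const.prodMk measurable_id)) hY]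
  refine lintegral_lintegral_swap (Measurable.aemeasurable ?_)
  exact hs.comp ((hY.comp measurable_fst).prodMk measurable_snd)

end PoissonApprox

theorem mainTheorem3 (d : ℕ) (hd : 1 ≤ d) (lam : ℝ) (hlam : 0 < lam) (θ : ℝ) (hθ : θ < 1) :
    ∃ C : ℝ, 0 < C ∧
      ∀ h : ℝ, 0 < h → lam * h ^ d ≤ θ →
      ∀ (Ω : Type*) [MeasurableSpace Ω] (μ : Measure Ω) [IsProbabilityMeasure μ]
        (X : PoissonApprox.Site d → Ω → PoissonApprox.Pt d)
        (b : PoissonApprox.Site d → Ω → Bool),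
      PoissonApprox.IsCubeProcess μ lam h X b →
      ∀ (S : Type*) [MeasurableSpace S] (W : Ω → S), Measurable W →
      IndepFun W (fun ω z => (X z ω, b z ω)) μ →
      ∀ (m : ℕ) (R : PoissonApprox.RandomIndexFunction d m S),
      -- `R` is bounded
      (∃ M : ℝ, ∀ᵐ ω ∂μ, ∀ᵐ x ∂(volume.restrict (PoissonApprox.cube h 0)),
        ∀ F : Finset (PoissonApprox.Site d), (F : Set _) ⊆ PoissonApprox.active b ω →
          ‖R.eval (W ω) (fun z => X z ω) x F‖ ≤ M) →
      -- `R` vanishes on the empty set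
      (∀ᵐ ω ∂μ, ∀ᵐ x ∂(volume.restrict (PoissonApprox.cube h 0)),
        R.eval (W ω) (fun z => X z ω) x ∅ = 0) →
      -- `R` is approximately local
      (∃ κ : ℝ, 0 < κ ∧ ∃ K : ℝ, ∀ᵐ ω ∂μ, ∀ᵐ x ∂(volume.restrict (PoissonApprox.cube h 0)),
        ∀ F : Finset (PoissonApprox.Site d), (F : Set _) ⊆ PoissonApprox.active b ω →
          ‖R.eval (W ω) (fun z => X z ω) x F‖ ≤ K * ∑ z ∈ F, Real.exp (-κ * ‖X z ω‖)) →
      ∀ i j k : ℕ, 1 ≤ i → 1 ≤ j → 1 ≤ k →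
        PoissonApprox.expect μ h (fun ω x =>
            ∑' H : PoissonApprox.tuples (PoissonApprox.active b ω) i ∅,
              ∑' G : PoissonApprox.tuples (PoissonApprox.active b ω) j H,
                (PoissonApprox.interBalls (fun z => X z ω) H).indicator 1 x *
                  PoissonApprox.sqSum (PoissonApprox.active b ω)
                    (R.eval (W ω) (fun z => X z ω) x) k G (H ∪ G))
          ≤ ENNReal.ofReal (C ^ i / (i.factorial : ℝ)) *
            PoissonApprox.expect μ h (fun ω x =>
              ∑' G : PoissonApprox.tuples (PoissonApprox.active b ω) j ∅,
                PoissonApprox.sqSum (PoissonApprox.active b ω)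
                  (R.eval (W ω) (fun z => X z ω) x) k G G) := by
  have hV : 0 < volume.real (Metric.ball (0 : PoissonApprox.Pt d) 1) :=
    ENNReal.toReal_pos (Metric.measure_ball_pos volume _ one_pos).ne' measure_ball_lt_top.ne
  -- Per site of `H`: `lam` times the ball volume from the sum over sites, and `(1 - θ)⁻¹` from the
  -- erasure.
  refine ⟨lam * volume.real (Metric.ball (0 : PoissonApprox.Pt d) 1) / (1 - θ),
    div_pos (mul_pos hlam hV) (sub_pos.2 hθ), ?_⟩
  intro h hh hle Ω _ μ _ X b hP S _ W hW hWind m R _ _ _ i j k _ _ _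
  have hlhs := PoissonApprox.expect_eq_lintegral h hW hP.measurable_config hWind
    (R.measurable_sumBalls i j k)
  have hrhs := PoissonApprox.expect_eq_lintegral h hW hP.measurable_config hWind
    (R.measurable_sumSq j k)
  simp only [← PoissonApprox.RandomIndexFunction.sumBalls_eq] at hlhs
  refine (hlhs.trans_le ?_).trans_eq (congrArg _ hrhs.symm)
  rw [← mul_div_assoc, ← lintegral_const_mul' _ _ ENNReal.ofReal_ne_top]
  simp only [← lintegral_const_mul' _ _ ENNReal.ofReal_ne_top]
  refine ENNReal.div_le_div_right (lintegral_mono fun s => lintegral_mono fun x => ?_) _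
  rw [lintegral_const_mul' _ _ ENNReal.ofReal_ne_top]
  simp only [PoissonApprox.RandomIndexFunction.sumBalls_eq]
  exact hP.lintegral_sumBalls_le hlam hh hθ hle R i j k s x
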